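/- Let $H,K$ be complex Hilbert spaces, let $x\in\mathcal B(H)$ be selfadjoint with positive and negative parts $x_\pm\ge 0$ ($x=x_+-x_-$, $x_+x_-=0$), let $E:=\operatorname{span}\{x\}$, and let $\mathrm C^*(E)\subseteq\mathcal B(H)$ be the (not necessarily unital) C*-algebra generated by $E$. For a selfadjoint subspace $F\subseteq\mathcal B(H)$, equip $M_n(F)\subseteq M_n(\mathcal B(H))$ with the induced involution, cone and norm. A linear map $\phi\colon F\to\mathcal B(K)$ is called completely positive if for every $n$ the amplification $\phi^{(n)}\colon M_n(F)\to M_n(\mathcal B(K))$, $[x_{ij}]\mapsto[\phi(x_{ij})]$, is selfadjoint (that is, $\phi^{(n)}(X^*)=\phi^{(n)}(X)^*$) and maps $M_n(F)_+$ into $M_n(\mathcal B(K))_+$; and $\|\phi\|_{\rm cb}:=\sup_n\|\phi^{(n)}\|$. Let $\phi\colon E\to\mathcal B(K)$ be completely positive. Then $\phi$ extends to a completely bounded completely positive map $\widetilde\phi\colon\mathrm C^*(E)\to\mathcal B(K)$. Moreover: 1. If $x_+=0$ or $x_-=0$, then there is such an extension with $\|\widetilde\phi\|_{\rm cb}=\|\phi\|_{\rm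 cb}$. 2. If $x_+\ne0$ and $x_-\neq 0$, then there is such an extension with $$\|\phi\|_{\rm cb}\le\|\widetilde\phi\|_{\rm cb}\le\frac{\|x\|}{\min\{\|x_+\|,\|x_-\|\}}\,\|\phi\|_{\rm cb},$$ which in addition is given by a positive $\mathcal B(K)$-valued Borel measure $Q$ on $\sigma(x)$ that vanishes on all Borel sets disjoint from $\{\min\sigma(x),\max\sigma(x)\}$, in the sense that $\widetilde\phi(f(x))=\int_{\sigma(x)}f\,dQ$ for every continuous $f\colon\sigma(x)\to\mathbb C$ with $f(x)\in\mathrm C^*(E)$. -/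

import Mathlib

open scoped ENNReal

namespace OneDimExt

variable {H K : Type*}
  [NormedAddCommGroup H] [InnerProductSpace ℂ H] [CompleteSpace H]
  [NormedAddCommGroup K] [InnerProductSpace ℂ K] [CompleteSpace K]

/-- The inclusion `M_n(E) ⊆ M_n(B(H))` for a subspace `E` of `B(H)`. The involution, the cone and
the norm of `M_n(E)` are those induced by the C⋆-algebra `M_n(B(H))`. -/
def incl {E : Submodule ℂ (H →L[ℂ] H)} {n : ℕ} (X : CStarMatrix (Fin n) (Fin n) E) :
    CStarMatrix (Fin n) (Fin n) (H →L[ℂ] H) :=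
  X.map (fun a => (a : H →L[ℂ] H))

/-- The amplification `φ⁽ⁿ⁾ : M_n(E) → M_n(B(K))`, `[x_ij] ↦ [φ(x_ij)]`. -/
def amp {E : Submodule ℂ (H →L[ℂ] H)} (φ : E →ₗ[ℂ] (K →L[ℂ] K)) {n : ℕ}
    (X : CStarMatrix (Fin n) (Fin n) E) : CStarMatrix (Fin n) (Fin n) (K →L[ℂ] K) :=
  X.map φ

/-- `φ : E → B(K)` is completely positive: for every `n`, the amplification `φ⁽ⁿ⁾` is positive,
i.e. it is selfadjoint (`φ⁽ⁿ⁾(X*) = φ⁽ⁿ⁾(X)*`) and maps `M_n(E)₊` into `M_n(B(K))₊`. As the cones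
of `E` need not span, selfadjointness is part of the definition. -/
def IsCompletelyPositive {E : Submodule ℂ (H →L[ℂ] H)} (φ : E →ₗ[ℂ] (K →L[ℂ] K)) : Prop :=
  ∀ n : ℕ,
    (∀ X Y : CStarMatrix (Fin n) (Fin n) E, incl Y = star (incl X) → amp φ Y = star (amp φ X)) ∧
    (∀ X : CStarMatrix (Fin n) (Fin n) E, 0 ≤ incl X → 0 ≤ amp φ X)

/-- The cb-norm `sup_n ‖φ⁽ⁿ⁾‖`, with value `∞` if `φ` is not completely bounded. -/
noncomputable def cbNorm {E : Submodule ℂ (H →L[ℂ] H)} (φ : E →ₗ[ℂ] (K →L[ℂ] K)) : ℝ≥0∞ :=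
  ⨆ (n : ℕ) (X : CStarMatrix (Fin n) (Fin n) E) (_ : ‖incl X‖ ≤ 1), ‖amp φ X‖ₑ

/-- The (not necessarily unital) C⋆-algebra `C*(E)` generated by `E` inside `B(H)`: the norm
closure of the ⋆-subalgebra generated by `E`, as a subspace of `B(H)`. -/
noncomputable def cstarGen (E : Submodule ℂ (H →L[ℂ] H)) : Submodule ℂ (H →L[ℂ] H) :=
  (NonUnitalStarAlgebra.adjoin ℂ (E : Set (H →L[ℂ] H))).topologicalClosure.toSubmodule

theorem le_cstarGen (E : Submodule ℂ (H →L[ℂ] H)) : E ≤ cstarGen E := fun _ ha =>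
  NonUnitalStarSubalgebra.le_topologicalClosure _ (NonUnitalStarAlgebra.subset_adjoin ℂ _ ha)

/-- `ψ` is a completely positive map on `C*(E)` that extends `φ : E → B(K)`. -/
def IsCPExtension {E : Submodule ℂ (H →L[ℂ] H)} (φ : E →ₗ[ℂ] (K →L[ℂ] K))
    (ψ : cstarGen E →ₗ[ℂ] (K →L[ℂ] K)) : Prop :=
  IsCompletelyPositive ψ ∧ ∀ a : E, ψ (Submodule.inclusion (le_cstarGen E) a) = φ a

/-- `ψ : C*(E) → B(K)` is given by integration against an operator-valued measure `Q` on the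
spectrum of `x`: `ψ(f(x)) = ∫ f dQ` for every continuous `f : σ(x) → ℂ` with `f(x) ∈ C*(E)`. -/
def IsGivenByMeasure {E : Submodule ℂ (H →L[ℂ] H)} (x : H →L[ℂ] H)
    (Q : MeasureTheory.VectorMeasure (spectrum ℝ x) (K →L[ℂ] K))
    (ψ : cstarGen E →ₗ[ℂ] (K →L[ℂ] K)) : Prop :=
  ∀ f : ℂ → ℂ, ContinuousOn f (spectrum ℂ x) → ∀ hf : cfc f x ∈ cstarGen E,
    ψ ⟨cfc f x, hf⟩ = Q.integral (fun t => f ((t : ℝ) : ℂ)) (ContinuousLinearMap.lsmul ℝ ℂ)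

end OneDimExt

/-! Put y = φ(x). A linear map on span{x} is determined by y, so any completely positive ψ on C*(x)
with ψ(x) = y extends φ. The candidates are ψ(f(x)) = f(s) p + f(t) q with s, t in σ(x) and p, q ≥
0. Each summand is a character times a positive operator, hence completely positive. If pq = 0, the
summands have orthogonal ranges at every matrix level, so ‖ψ‖_cb ≤ max(‖p‖, ‖q‖)
(`norm_map_smul_add_smul_le`).

If x is indefinite, max σ(x) = ‖x₊‖ and min σ(x) = -‖x₋‖. With s, t these two points, p = y₊/‖x₊‖
and q = y₋/‖x₋‖ give ψ(x) = y₊ - y₋ = y. The bound follows from ‖y₊‖, ‖y₋‖ ≤ ‖y‖ ≤ ‖x‖ ‖φ‖_cb. If x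
≠ 0 is semidefinite, a single spectral point t with |t| = ‖x‖ and p = y/t ≥ 0 suffices, and ‖p‖ =
‖y‖/‖x‖ loses nothing. -/

namespace OneDimExt

/-! ### Orthogonality, positivity and characters on matrix algebras -/

section CStar

/-- Orthogonal elements of a C⋆-algebra: the norm of the sum is at most the larger norm. -/
theorem norm_add_le_max_of_orthogonal {A : Type*} [NonUnitalCStarAlgebra A] {s t : A}
    (h₁ : star s * t = 0) (h₂ : s * star t = 0) : ‖s + t‖ ≤ max ‖s‖ ‖t‖ := by
  have h₃ : star t * s = 0 := by simpa using congrArg star h₁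
  have hsum : star (s + t) * (s + t) = star s * s + star t * t := by
    rw [star_add, add_mul, mul_add, mul_add, h₁, h₃]; abel
  have horth : star s * s * (star t * t) = 0 := by
    rw [mul_assoc, ← mul_assoc s, h₂, zero_mul, mul_zero]
  have horth' : star t * t * (star s * s) = 0 := by simpa using congrArg star horth
  have key := IsStarNormal.norm_add_eq_max (IsSelfAdjoint.star_mul_self s).isStarNormal
    (IsSelfAdjoint.star_mul_self t).isStarNormal (horth.trans horth'.symm) horth
  rw [← hsum, CStarRing.norm_star_mul_self, CStarRing.norm_star_mul_self,
    CStarRing.norm_star_mul_self] at key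
  rcases max_cases (‖s‖ * ‖s‖) (‖t‖ * ‖t‖) with h | h
  · exact le_max_of_le_left ((mul_self_le_mul_self_iff (norm_nonneg _) (norm_nonneg _)).2
      (key.trans h.1).le)
  · exact le_max_of_le_right ((mul_self_le_mul_self_iff (norm_nonneg _) (norm_nonneg _)).2
      (key.trans h.1).le)

/-- An injective ⋆-homomorphism of C⋆-algebras reflects positivity. -/
theorem nonneg_of_map_nonneg {A B : Type*} [NonUnitalCStarAlgebra A] [PartialOrder A]
    [StarOrderedRing A] [NonUnitalCStarAlgebra B] [PartialOrder B] [StarOrderedRing B]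
    (f : A →⋆ₙₐ[ℂ] B) (hf : Function.Injective f) {a : A} (ha : 0 ≤ f a) : 0 ≤ a := by
  have hsa : IsSelfAdjoint a := hf (by rw [map_star]; exact (IsSelfAdjoint.of_nonneg ha).star_eq)
  -- By uniqueness of the Jordan decomposition, f a⁻ is the negative part of f a.
  have hneg : f a⁻ = 0 := by
    have h := (CFC.posPart_negPart_unique (a := f a) (b := f a⁺) (c := f a⁻)
      (by rw [← map_sub, CFC.posPart_sub_negPart a hsa])
      (by rw [← map_mul, CFC.posPart_mul_negPart, map_zero])
      (map_nonneg f (CFC.posPart_nonneg a)) (map_nonneg f (CFC.negPart_nonneg a))).2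
    rw [← h]
    exact (CFC.negPart_eq_zero_iff (f a)).2 ha
  exact (CFC.negPart_eq_zero_iff a).1 (hf (by rw [hneg, map_zero]))

theorem mul_nonneg_of_commute {A : Type*} [NonUnitalCStarAlgebra A] [PartialOrder A]
    [StarOrderedRing A] {a b : A} (ha : 0 ≤ a) (hb : 0 ≤ b) (h : Commute a b) : 0 ≤ a * b :=
  Commute.mul_nonneg ha hb h

variable {B : Type*} [CStarAlgebra B] {n : ℕ}

/-- The diagonal embedding of a C⋆-algebra into the matrices over it. -/
def diagonalHom (B : Type*) [CStarAlgebra B] (n : ℕ) : B →⋆ₙₐ[ℂ] CStarMatrix (Fin n) (Fin n) B where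
  toFun b := CStarMatrix.ofMatrix (Matrix.diagonal fun _ => b)
  map_smul' c b := by
    ext i j
    by_cases h : i = j <;> simp [h]
  map_zero' := by ext i j; simp
  map_add' a b := by
    ext i j
    by_cases h : i = j <;> simp [h]
  map_mul' a b := by
    ext i j
    simp [CStarMatrix.mul_apply, Matrix.diagonal_apply]
  map_star' b := by
    ext i j
    by_cases h : i = j
    · simp [h, CStarMatrix.star_apply]
    · simp [h, Ne.symm h, CStarMatrix.star_apply]

theorem diagonalHom_apply (b : B) (i j : Fin n) :
    diagonalHom B n b i j = if i = j then b else 0 := by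
  simp [diagonalHom, Matrix.diagonal_apply]

theorem diagonalHom_one_apply (b : B) : diagonalHom B 1 b = fun _ _ => b := by
  refine CStarMatrix.ext fun i j => ?_
  rw [diagonalHom_apply, if_pos (Subsingleton.elim i j)]

theorem diagonalHom_one_injective (B : Type*) [CStarAlgebra B] :
    Function.Injective (diagonalHom B 1) := fun a b h => by
  rw [diagonalHom_one_apply, diagonalHom_one_apply] at h
  exact congrFun (congrFun h 0) 0

variable {A : Type*} [CStarAlgebra A]

/-- The scalar ⋆-homomorphism of a unital C⋆-algebra given by a character. -/
def scalarHom (B : Type*) [CStarAlgebra B] (χ : A →⋆ₐ[ℂ] ℂ) : A →⋆ₐ[ℂ] B :=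
  (StarAlgHom.ofId ℂ B).comp χ

theorem scalarHom_apply (χ : A →⋆ₐ[ℂ] ℂ) (a : A) : scalarHom B χ a = χ a • (1 : B) := by
  simp [scalarHom, Algebra.algebraMap_eq_smul_one]

/-- The ⋆-homomorphism `M_n(A) → M_n(B)` induced by a character of `A`. -/
noncomputable def matrixCharacter (B : Type*) [CStarAlgebra B] (n : ℕ) (χ : A →⋆ₐ[ℂ] ℂ) :
    CStarMatrix (Fin n) (Fin n) A →⋆ₙₐ[ℂ] CStarMatrix (Fin n) (Fin n) B :=
  CStarMatrix.mapₙₐ (scalarHom B χ : A →⋆ₙₐ[ℂ] B)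

theorem matrixCharacter_apply (χ : A →⋆ₐ[ℂ] ℂ) (X : CStarMatrix (Fin n) (Fin n) A) (i j : Fin n) :
    matrixCharacter B n χ X i j = χ (X i j) • (1 : B) := by
  simp [matrixCharacter, scalarHom_apply]

theorem matrixCharacter_mul_diagonalHom (χ : A →⋆ₐ[ℂ] ℂ) (X : CStarMatrix (Fin n) (Fin n) A)
    (b : B) : matrixCharacter B n χ X * diagonalHom B n b = X.map fun a => χ a • b := by
  ext i j
  simp [CStarMatrix.mul_apply, matrixCharacter_apply, diagonalHom_apply]

theorem commute_matrixCharacter_diagonalHom (χ : A →⋆ₐ[ℂ] ℂ)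
    (X : CStarMatrix (Fin n) (Fin n) A) (b : B) :
    Commute (matrixCharacter B n χ X) (diagonalHom B n b) := by
  ext i j
  simp [CStarMatrix.mul_apply, matrixCharacter_apply, diagonalHom_apply]

variable [PartialOrder A] [StarOrderedRing A] [PartialOrder B] [StarOrderedRing B]

/-- The matrix is the product of the commuting positive elements χ⁽ⁿ⁾(X) ⊗ 1 and 1 ⊗ b. -/
theorem map_smul_nonneg (χ : A →⋆ₐ[ℂ] ℂ) {X : CStarMatrix (Fin n) (Fin n) A} (hX : 0 ≤ X)
    {b : B} (hb : 0 ≤ b) : 0 ≤ X.map fun a => χ a • b := by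
  rw [← matrixCharacter_mul_diagonalHom]
  exact mul_nonneg_of_commute (map_nonneg _ hX) (map_nonneg _ hb)
    (commute_matrixCharacter_diagonalHom χ X b)

theorem norm_map_smul_le (χ : A →⋆ₐ[ℂ] ℂ) (X : CStarMatrix (Fin n) (Fin n) A) (b : B) :
    ‖X.map fun a => χ a • b‖ ≤ ‖X‖ * ‖b‖ := by
  rw [← matrixCharacter_mul_diagonalHom]
  exact (norm_mul_le _ _).trans (mul_le_mul (NonUnitalStarAlgHom.norm_apply_le _ _)
    (NonUnitalStarAlgHom.norm_apply_le _ _) (norm_nonneg _) (norm_nonneg _))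

/-- Since pq = 0, the two summands are orthogonal, so their norms combine as a maximum instead of a
sum. -/
theorem norm_map_smul_add_smul_le (χ₁ χ₂ : A →⋆ₐ[ℂ] ℂ) (X : CStarMatrix (Fin n) (Fin n) A)
    {p q : B} (hp : IsSelfAdjoint p) (hq : IsSelfAdjoint q) (hpq : p * q = 0) :
    ‖X.map fun a => χ₁ a • p + χ₂ a • q‖ ≤ ‖X‖ * max ‖p‖ ‖q‖ := by
  have hsum : (X.map fun a => χ₁ a • p + χ₂ a • q) =
      (X.map fun a => χ₁ a • p) + X.map fun a => χ₂ a • q := by ext i j; simp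
  have hstar (r s : B) (χ χ' : A →⋆ₐ[ℂ] ℂ) (hr : IsSelfAdjoint r) (hrs : r * s = 0) :
      star (X.map fun a => χ a • r) * (X.map fun a => χ' a • s) = 0 := by
    ext i j
    simp [CStarMatrix.mul_apply, CStarMatrix.star_apply, hr.star_eq, hrs]
  have hstar' (r s : B) (χ χ' : A →⋆ₐ[ℂ] ℂ) (hs : IsSelfAdjoint s) (hrs : r * s = 0) :
      (X.map fun a => χ a • r) * star (X.map fun a => χ' a • s) = 0 := by
    ext i j
    simp [CStarMatrix.mul_apply, CStarMatrix.star_apply, hs.star_eq, hrs]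
  rw [hsum]
  refine (norm_add_le_max_of_orthogonal (hstar p q _ _ hp hpq) (hstar' p q _ _ hq hpq)).trans ?_
  rw [mul_max_of_nonneg _ _ (norm_nonneg _)]
  exact max_le_max (norm_map_smul_le _ _ _) (norm_map_smul_le _ _ _)

end CStar

/-! ### Two-point maps are completely positive and completely bounded -/

section TwoPoint

variable {H K A : Type*}
  [NormedAddCommGroup H] [InnerProductSpace ℂ H] [NormedAddCommGroup K] [InnerProductSpace ℂ K]
  [CStarAlgebra A]

/-- The map `a ↦ χ₁(a) p + χ₂(a) q` on a subspace `F` of `B(H)` that is contained, by way of `ρ`,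
in a C⋆-algebra with characters `χ₁` and `χ₂`. -/
noncomputable def twoPointMap {F : Submodule ℂ (H →L[ℂ] H)} (ρ : F →ₗ[ℂ] A) (χ₁ χ₂ : A →⋆ₐ[ℂ] ℂ)
    (p q : K →L[ℂ] K) : F →ₗ[ℂ] (K →L[ℂ] K) :=
  ((χ₁ : A →ₗ[ℂ] ℂ).comp ρ).smulRight p + ((χ₂ : A →ₗ[ℂ] ℂ).comp ρ).smulRight q

theorem twoPointMap_apply {F : Submodule ℂ (H →L[ℂ] H)} (ρ : F →ₗ[ℂ] A) (χ₁ χ₂ : A →⋆ₐ[ℂ] ℂ)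
    (p q : K →L[ℂ] K) (a : F) : twoPointMap ρ χ₁ χ₂ p q a = χ₁ (ρ a) • p + χ₂ (ρ a) • q := rfl

variable [CompleteSpace H] [CompleteSpace K] {F : Submodule ℂ (H →L[ℂ] H)} {ρ : F →ₗ[ℂ] A} (ι : A →⋆ₐ[ℂ] (H →L[ℂ] H))
  (χ₁ χ₂ : A →⋆ₐ[ℂ] ℂ)
  {p q : K →L[ℂ] K} {n : ℕ}

theorem mapₙₐ_injective (hι : Function.Injective ι) : Function.Injective
    (CStarMatrix.mapₙₐ (n := Fin n) (ι : A →⋆ₙₐ[ℂ] (H →L[ℂ] H))) := fun X Y h => by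
  ext i j
  exact hι (congrFun (congrFun h i) j)

theorem mapₙₐ_map (hρ : ∀ a : F, ι (ρ a) = a) (X : CStarMatrix (Fin n) (Fin n) F) :
    CStarMatrix.mapₙₐ (ι : A →⋆ₙₐ[ℂ] (H →L[ℂ] H)) (X.map ρ) = incl X := by
  refine CStarMatrix.ext fun i j => ?_
  exact hρ (X i j)

theorem isCompletelyPositive_twoPointMap (hι : Function.Injective ι) (hρ : ∀ a : F, ι (ρ a) = a)
    (hp : 0 ≤ p) (hq : 0 ≤ q) :
    IsCompletelyPositive (twoPointMap ρ χ₁ χ₂ p q) := by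
  let := CStarAlgebra.spectralOrder A
  let := CStarAlgebra.spectralOrderedRing A
  refine fun n => ⟨fun X Y hXY => ?_, fun X hX => ?_⟩
  · refine CStarMatrix.ext fun i j => ?_
    have h : ρ (Y i j) = star (ρ (X j i)) :=
      hι (by rw [map_star, hρ, hρ]; exact congrFun (congrFun hXY i) j)
    change twoPointMap ρ χ₁ χ₂ p q (Y i j) = star (twoPointMap ρ χ₁ χ₂ p q (X j i))
    rw [twoPointMap_apply, twoPointMap_apply, h, star_add, star_smul, star_smul, map_star, map_star,
      (IsSelfAdjoint.of_nonneg hp).star_eq, (IsSelfAdjoint.of_nonneg hq).star_eq]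
  -- Positivity is given in M_n(B(H)); it descends to M_n(A) because the amplification of ι is
  -- injective.
  · have hX' : 0 ≤ X.map ρ := by
      refine nonneg_of_map_nonneg _ (mapₙₐ_injective ι hι) ?_
      rwa [mapₙₐ_map ι hρ]
    exact add_nonneg (map_smul_nonneg χ₁ hX' hp) (map_smul_nonneg χ₂ hX' hq)

theorem cbNorm_twoPointMap_le (hι : Function.Injective ι) (hρ : ∀ a : F, ι (ρ a) = a)
    (hp : IsSelfAdjoint p) (hq : IsSelfAdjoint q) (hpq : p * q = 0) :
    cbNorm (twoPointMap ρ χ₁ χ₂ p q) ≤ ENNReal.ofReal (max ‖p‖ ‖q‖) := by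
  let := CStarAlgebra.spectralOrder A
  let := CStarAlgebra.spectralOrderedRing A
  refine iSup_le fun n => iSup_le fun X => iSup_le fun hX => ?_
  have hX' : ‖X.map ρ‖ ≤ 1 := by
    rw [← NonUnitalStarAlgHom.norm_map _ (mapₙₐ_injective ι hι), mapₙₐ_map ι hρ]
    exact hX
  rw [← ofReal_norm]
  refine ENNReal.ofReal_le_ofReal
    ((norm_map_smul_add_smul_le χ₁ χ₂ (X.map ρ) hp hq hpq).trans ?_)
  exact mul_le_of_le_one_left (le_max_of_le_left (norm_nonneg p)) hX'

end TwoPoint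

/-! ### Consequences of complete positivity and the cb-norm at level n = 1 -/

section CbNorm

variable {H K : Type*}
  [NormedAddCommGroup H] [InnerProductSpace ℂ H] [CompleteSpace H]
  [NormedAddCommGroup K] [InnerProductSpace ℂ K] [CompleteSpace K]
  {E : Submodule ℂ (H →L[ℂ] H)} {φ : E →ₗ[ℂ] (K →L[ℂ] K)}

theorem cbNorm_le_of_isCPExtension {ψ : cstarGen E →ₗ[ℂ] (K →L[ℂ] K)} (h : IsCPExtension φ ψ) :
    cbNorm φ ≤ cbNorm ψ := by
  refine iSup_le fun n => iSup_le fun X => iSup_le fun hX => ?_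
  let X' : CStarMatrix (Fin n) (Fin n) (cstarGen E) :=
    X.map (Submodule.inclusion (le_cstarGen E))
  have hamp : amp ψ X' = amp φ X := by
    refine CStarMatrix.ext fun i j => ?_
    exact h.2 (X i j)
  have hincl : incl X' = incl X := rfl
  rw [← hamp]
  exact le_iSup_of_le n (le_iSup_of_le X' (le_iSup_of_le (hincl ▸ hX) le_rfl))

theorem norm_incl_const (a : E) : ‖incl (n := 1) (fun _ _ => a)‖ = ‖a‖ := by
  have h := NonUnitalStarAlgHom.norm_map (diagonalHom (H →L[ℂ] H) 1) (diagonalHom_one_injective _) a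
  rwa [diagonalHom_one_apply] at h

theorem enorm_apply_le_cbNorm {a : E} (ha : ‖a‖ ≤ 1) : ‖φ a‖ₑ ≤ cbNorm φ := by
  refine le_trans ?_ (le_iSup_of_le 1 (le_iSup_of_le (fun _ _ => a)
    (le_iSup_of_le ((norm_incl_const a).le.trans ha) le_rfl)))
  rw [← ofReal_norm, ← ofReal_norm]
  exact ENNReal.ofReal_le_ofReal
    (CStarMatrix.norm_entry_le_norm (M := amp φ (n := 1) (fun _ _ => a)) (i := 0) (j := 0))

theorem norm_div_le_cbNorm (a : E) : ENNReal.ofReal (‖φ a‖ / ‖a‖) ≤ cbNorm φ := by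
  rcases eq_or_ne a 0 with rfl | ha
  · simp
  refine le_trans (le_of_eq ?_)
    (enorm_apply_le_cbNorm (φ := φ) (a := ((‖a‖⁻¹ : ℝ) : ℂ) • a) ?_)
  · rw [map_smul, ← ofReal_norm, norm_smul, Complex.norm_real, norm_inv, norm_norm, div_eq_inv_mul]
  · rw [norm_smul, Complex.norm_real, norm_inv, norm_norm, inv_mul_cancel₀ (norm_ne_zero_iff.2 ha)]

theorem isSelfAdjoint_apply (hφ : IsCompletelyPositive φ) {a : E}
    (ha : IsSelfAdjoint (a : H →L[ℂ] H)) : IsSelfAdjoint (φ a) := by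
  have h := (hφ 1).1 (fun _ _ => a) (fun _ _ => a) (CStarMatrix.ext fun _ _ => ha.star_eq.symm)
  exact (congrFun (congrFun h 0) 0).symm

theorem apply_nonneg (hφ : IsCompletelyPositive φ) {a : E} (ha : 0 ≤ (a : H →L[ℂ] H)) :
    0 ≤ φ a := by
  have hdiag := map_nonneg (diagonalHom (H →L[ℂ] H) 1) ha
  rw [diagonalHom_one_apply] at hdiag
  have h : 0 ≤ amp φ (n := 1) (fun _ _ => a) := (hφ 1).2 (fun _ _ => a) hdiag
  refine nonneg_of_map_nonneg (diagonalHom (K →L[ℂ] K) 1) (diagonalHom_one_injective _) ?_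
  rwa [diagonalHom_one_apply]

end CbNorm

/-! ### Point evaluations and the extreme points of the spectrum -/

section Spectrum

variable {A : Type*} [CStarAlgebra A]

/-- The character of `C*(1, x)` given by evaluation at a point of the spectrum of `x`. -/
noncomputable def evalSpectrum (x : A) [IsStarNormal x] (z : spectrum ℂ x) :
    StarAlgebra.elemental ℂ x →⋆ₐ[ℂ] ℂ :=
  (ContinuousMap.evalStarAlgHom ℂ ℂ z).comp
    ((continuousFunctionalCalculus x).symm : StarAlgebra.elemental ℂ x →⋆ₐ[ℂ] C(spectrum ℂ x, ℂ))

theorem evalSpectrum_of_eq_cfc {x : A} [IsStarNormal x] (z : spectrum ℂ x) {f : ℂ → ℂ}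
    (hf : ContinuousOn f (spectrum ℂ x)) {a : StarAlgebra.elemental ℂ x} (ha : (a : A) = cfc f x) :
    evalSpectrum x z a = f z := by
  have h : a = continuousFunctionalCalculus x ⟨_, hf.domRestrict⟩ := by
    apply Subtype.ext
    rw [ha, cfc_apply f x, cfcHom_eq_of_isStarNormal]
    rfl
  rw [h]
  change (continuousFunctionalCalculus x).symm (continuousFunctionalCalculus x _) z = f z
  rw [StarAlgEquiv.symm_apply_apply]
  rfl

theorem evalSpectrum_of_eq_self {x : A} [IsStarNormal x] (z : spectrum ℂ x)
    {a : StarAlgebra.elemental ℂ x} (ha : (a : A) = x) : evalSpectrum x z a = z :=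
  evalSpectrum_of_eq_cfc (f := id) z continuousOn_id (by rw [ha, cfc_id ℂ x])

theorem spectrum_posPart {x : A} (hx : IsSelfAdjoint x) :
    spectrum ℝ x⁺ = (fun t : ℝ => t⁺) '' spectrum ℝ x := by
  have hcont : Continuous fun t : ℝ => t⁺ := continuous_id.sup continuous_const
  rw [CFC.posPart_def, cfcₙ_eq_cfc hcont.continuousOn posPart_zero,
    cfc_map_spectrum (fun t : ℝ => t⁺) x hx hcont.continuousOn]

theorem le_norm_posPart {x : A} (hx : IsSelfAdjoint x) {t : ℝ} (ht : t ∈ spectrum ℝ x) :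
    t ≤ ‖x⁺‖ := by
  rcases subsingleton_or_nontrivial A with _ | _
  · rw [spectrum.of_subsingleton] at ht
    exact ht.elim
  have h : t⁺ ∈ spectrum ℝ x⁺ := by
    rw [spectrum_posPart hx]
    exact ⟨t, ht, rfl⟩
  exact (le_posPart t).trans ((le_abs_self _).trans (spectrum.norm_le_norm_of_mem h))

theorem neg_norm_negPart_le {x : A} (hx : IsSelfAdjoint x) {t : ℝ} (ht : t ∈ spectrum ℝ x) :
    -‖x⁻‖ ≤ t := by
  have h := le_norm_posPart hx.neg (t := -t) (by rwa [← spectrum.neg_eq, Set.neg_mem_neg])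
  rw [CFC.posPart_neg] at h
  exact neg_le.1 h

variable [PartialOrder A] [StarOrderedRing A]

/-- The norm of x⁺ ≥ 0 lies in σ(x⁺), so it equals t⁺ for some t in σ(x); being nonzero, it is t
itself. -/
theorem norm_posPart_mem_spectrum {x : A} (hx : IsSelfAdjoint x) (h : x⁺ ≠ 0) :
    ‖x⁺‖ ∈ spectrum ℝ x := by
  have : Nontrivial A := ⟨_, _, h⟩
  have hmem := CStarAlgebra.norm_mem_spectrum_of_nonneg (CFC.posPart_nonneg x)
  rw [spectrum_posPart hx] at hmem
  obtain ⟨t, ht, htx⟩ := hmem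
  change t⁺ = ‖x⁺‖ at htx
  have hpos : 0 < t⁺ := by
    rw [htx]
    exact norm_pos_iff.2 h
  rw [← htx]
  simpa [posPart_of_nonneg (posPart_pos_iff.1 hpos).le] using ht

theorem neg_norm_negPart_mem_spectrum {x : A} (hx : IsSelfAdjoint x) (h : x⁻ ≠ 0) :
    -‖x⁻‖ ∈ spectrum ℝ x := by
  have h := norm_posPart_mem_spectrum hx.neg (by rwa [CFC.posPart_neg])
  rwa [CFC.posPart_neg, ← spectrum.neg_eq, Set.mem_neg] at h

end Spectrum

theorem norm_inv_smul_le {V : Type*} [NormedAddCommGroup V] [NormedSpace ℝ V] {v : V} {c d r : ℝ}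
    (hd : 0 < d) (hdc : d ≤ c) (hv : ‖v‖ ≤ r) : ‖c⁻¹ • v‖ ≤ d⁻¹ * r := by
  rw [norm_smul, norm_inv, Real.norm_of_nonneg (hd.le.trans hdc)]
  exact mul_le_mul (inv_anti₀ hd hdc) hv (norm_nonneg _) (inv_nonneg.2 hd.le)

/-! ### Operator-valued point masses -/

section Measure

open MeasureTheory

variable {X V : Type*} [MeasurableSpace X] [NormedAddCommGroup V]

/-- Holds for every set, since a vector measure is 0 on nonmeasurable sets. -/
theorem dirac_nonneg [PartialOrder V] {v : V} (hv : 0 ≤ v) (a : X) (s : Set X) :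
    0 ≤ VectorMeasure.dirac a v s := by
  by_cases hs : MeasurableSet s
  · by_cases ha : a ∈ s
    · rwa [VectorMeasure.dirac_apply_of_mem hs ha]
    · rw [VectorMeasure.dirac_apply_of_notMem ha]
  · rw [VectorMeasure.not_measurable _ hs]

theorem integrable_dirac_vectorMeasure [MeasurableSingletonClass X] {E : Type*}
    [NormedAddCommGroup E] (a : X) (v : V) (f : X → E) :
    (VectorMeasure.dirac a v).Integrable f := by
  rw [VectorMeasure.Integrable, VectorMeasure.variation_dirac]
  exact (integrable_dirac enorm_lt_top).smul_measure enorm_ne_top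

end Measure

/-! ### Construction of the extensions -/

section Extension

variable {H K : Type*}
  [NormedAddCommGroup H] [InnerProductSpace ℂ H] [CompleteSpace H]
  [NormedAddCommGroup K] [InnerProductSpace ℂ K] [CompleteSpace K]
  {x : H →L[ℂ] H}

/-- Lets characters of the unital algebra C*(1, x) be restricted to C*(x), whether or not the latter
is unital. -/
theorem cstarGen_span_le_elemental (x : H →L[ℂ] H) {a : H →L[ℂ] H}
    (ha : a ∈ cstarGen (Submodule.span ℂ {x})) : a ∈ StarAlgebra.elemental ℂ x := by
  have h : NonUnitalStarAlgebra.adjoin ℂ (Submodule.span ℂ {x} : Set (H →L[ℂ] H)) ≤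
      (StarAlgebra.elemental ℂ x).toNonUnitalStarSubalgebra := by
    refine NonUnitalStarAlgebra.adjoin_le ?_
    have : Submodule.span ℂ {x} ≤ (StarAlgebra.elemental ℂ x).toSubalgebra.toSubmodule :=
      Submodule.span_le.2 (Set.singleton_subset_iff.2 (StarAlgebra.elemental.self_mem ℂ x))
    exact this
  exact NonUnitalStarSubalgebra.topologicalClosure_minimal _ h
    (StarAlgebra.elemental.isClosed ℂ x) ha

/-- The inclusion of `C*(x)` in the unital C⋆-algebra generated by `x`. -/
noncomputable def toElemental (x : H →L[ℂ] H) :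
    cstarGen (Submodule.span ℂ {x}) →ₗ[ℂ] StarAlgebra.elemental ℂ x where
  toFun a := ⟨a, cstarGen_span_le_elemental x a.2⟩
  map_add' _ _ := rfl
  map_smul' _ _ := rfl

/-- The map `f(x) ↦ f(s) p + f(t) q` on `C*(x)`. -/
noncomputable def spectralTwoPoint (x : H →L[ℂ] H) [IsStarNormal x] (s t : spectrum ℂ x)
    (p q : K →L[ℂ] K) : cstarGen (Submodule.span ℂ {x}) →ₗ[ℂ] (K →L[ℂ] K) :=
  twoPointMap (toElemental x) (evalSpectrum x s) (evalSpectrum x t) p q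

theorem spectralTwoPoint_cfc [IsStarNormal x] (s t : spectrum ℂ x) (p q : K →L[ℂ] K) {f : ℂ → ℂ}
    (hf : ContinuousOn f (spectrum ℂ x)) (hfx : cfc f x ∈ cstarGen (Submodule.span ℂ {x})) :
    spectralTwoPoint x s t p q ⟨cfc f x, hfx⟩ = f s • p + f t • q := by
  rw [spectralTwoPoint, twoPointMap_apply, evalSpectrum_of_eq_cfc s hf rfl,
    evalSpectrum_of_eq_cfc t hf rfl]

theorem isCPExtension_spectralTwoPoint [IsStarNormal x]
    {φ : Submodule.span ℂ {x} →ₗ[ℂ] (K →L[ℂ] K)} (s t : spectrum ℂ x)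
    {p q : K →L[ℂ] K} (hp : 0 ≤ p) (hq : 0 ≤ q)
    (hφ : φ ⟨x, Submodule.mem_span_singleton_self x⟩ = (s : ℂ) • p + (t : ℂ) • q) :
    IsCPExtension φ (spectralTwoPoint x s t p q) := by
  refine ⟨isCompletelyPositive_twoPointMap (StarAlgebra.elemental ℂ x).subtype
    _ _ Subtype.val_injective (fun _ => rfl) hp hq, fun ⟨a, ha⟩ => ?_⟩
  obtain ⟨c, rfl⟩ := Submodule.mem_span_singleton.1 ha
  have hself (z : spectrum ℂ x) : evalSpectrum x z
      ⟨x, StarAlgebra.elemental.self_mem ℂ x⟩ = z := evalSpectrum_of_eq_self z rfl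
  change spectralTwoPoint x s t p q (c • Submodule.inclusion (le_cstarGen _)
    ⟨x, Submodule.mem_span_singleton_self x⟩) =
      φ (c • ⟨x, Submodule.mem_span_singleton_self x⟩)
  rw [map_smul, map_smul, hφ]
  congr 1
  exact congrArg₂ (· • p + · • q) (hself s) (hself t)

theorem cbNorm_spectralTwoPoint_le [IsStarNormal x] (s t : spectrum ℂ x)
    {p q : K →L[ℂ] K} (hp : 0 ≤ p) (hq : 0 ≤ q) (hpq : p * q = 0) :
    cbNorm (spectralTwoPoint x s t p q) ≤ ENNReal.ofReal (max ‖p‖ ‖q‖) :=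
  cbNorm_twoPointMap_le (StarAlgebra.elemental ℂ x).subtype
    _ _ Subtype.val_injective (fun _ => rfl) (.of_nonneg hp) (.of_nonneg hq) hpq

theorem isGivenByMeasure_spectralTwoPoint [IsStarNormal x] (s t : spectrum ℝ x)
    (s' t' : spectrum ℂ x) (hs : (s' : ℂ) = (s : ℝ)) (ht : (t' : ℂ) = (t : ℝ)) (p q : K →L[ℂ] K) :
    IsGivenByMeasure x (MeasureTheory.VectorMeasure.dirac s p +
      MeasureTheory.VectorMeasure.dirac t q) (spectralTwoPoint x s' t' p q) := by
  intro f hf hfx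
  rw [spectralTwoPoint_cfc s' t' p q hf hfx, MeasureTheory.VectorMeasure.integral_add_vectorMeasure
    (integrable_dirac_vectorMeasure _ _ _) (integrable_dirac_vectorMeasure _ _ _),
    MeasureTheory.VectorMeasure.integral_dirac, MeasureTheory.VectorMeasure.integral_dirac, hs, ht]
  rfl

/-- If a nonzero spectral value `t` has modulus `‖x‖` and `t⁻¹ φ(x) ≥ 0`, then `φ` extends to
`C*(x)` with the same cb-norm. -/
theorem exists_extension_of_mem_spectrum (hx : IsSelfAdjoint x)
    (φ : Submodule.span ℂ {x} →ₗ[ℂ] (K →L[ℂ] K)) {t : ℝ} (ht : t ∈ spectrum ℝ x)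
    (ht₀ : t ≠ 0) (htx : |t| = ‖x‖)
    (hφ : 0 ≤ t⁻¹ • φ ⟨x, Submodule.mem_span_singleton_self x⟩) :
    ∃ ψ : cstarGen (Submodule.span ℂ {x}) →ₗ[ℂ] (K →L[ℂ] K),
      IsCPExtension φ ψ ∧ cbNorm ψ = cbNorm φ ∧ cbNorm ψ < ∞ := by
  have := hx.isStarNormal
  set y := φ ⟨x, Submodule.mem_span_singleton_self x⟩ with hy
  let z : spectrum ℂ x := ⟨(t : ℂ), spectrum.algebraMap_mem ℂ ht⟩
  -- Taking the second operator to be 0 leaves a one-point map.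
  have hle := cbNorm_spectralTwoPoint_le z z hφ le_rfl (mul_zero _)
  have hext : IsCPExtension φ (spectralTwoPoint x z z (t⁻¹ • y) 0) := by
    refine isCPExtension_spectralTwoPoint z z hφ le_rfl ?_
    change y = (t : ℂ) • t⁻¹ • y + (t : ℂ) • 0
    rw [smul_zero, add_zero, Complex.coe_smul, smul_inv_smul₀ ht₀]
  refine ⟨_, hext, le_antisymm (hle.trans (le_trans (le_of_eq ?_)
    (norm_div_le_cbNorm ⟨x, Submodule.mem_span_singleton_self x⟩)))
    (cbNorm_le_of_isCPExtension hext), hle.trans_lt ENNReal.ofReal_lt_top⟩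
  rw [norm_zero, max_eq_left (norm_nonneg _), norm_smul, norm_inv, Real.norm_eq_abs, htx,
    inv_mul_eq_div]
  rfl

theorem exists_extension_of_semidefinite (hx : IsSelfAdjoint x)
    (φ : Submodule.span ℂ {x} →ₗ[ℂ] (K →L[ℂ] K)) (hφ : IsCompletelyPositive φ)
    (h : x⁺ = 0 ∨ x⁻ = 0) :
    ∃ ψ : cstarGen (Submodule.span ℂ {x}) →ₗ[ℂ] (K →L[ℂ] K),
      IsCPExtension φ ψ ∧ cbNorm ψ = cbNorm φ ∧ cbNorm ψ < ∞ := by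
  have hsub := CFC.posPart_sub_negPart x hx
  -- For x = 0 there is no nonzero spectral value to evaluate at, but φ = 0 and the zero map extends
  -- it.
  rcases eq_or_ne x 0 with hx₀ | hx₀
  · have hzero (F : Submodule ℂ (H →L[ℂ] H)) : cbNorm (0 : F →ₗ[ℂ] (K →L[ℂ] K)) = 0 := by
      refine le_antisymm (iSup_le fun n => iSup_le fun X => iSup_le fun _ => ?_) zero_le
      have : amp (0 : F →ₗ[ℂ] (K →L[ℂ] K)) X = 0 := rfl
      rw [this]
      exact (enorm_zero (E := CStarMatrix (Fin n) (Fin n) (K →L[ℂ] K))).le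
    have hspan (a : Submodule.span ℂ {x}) : a = 0 := by
      obtain ⟨c, hc⟩ := Submodule.mem_span_singleton.1 a.2
      exact Subtype.ext (by rw [← hc, hx₀, smul_zero]; rfl)
    have hφ₀ : φ = 0 := LinearMap.ext fun a => by rw [hspan a, map_zero, map_zero]
    refine ⟨0, ⟨fun n => ⟨fun X Y _ => ?_, fun X _ => le_rfl⟩, fun a => ?_⟩, ?_, ?_⟩
    · exact (star_zero (CStarMatrix (Fin n) (Fin n) (K →L[ℂ] K))).symm
    · rw [hφ₀]; rfl
    · rw [hφ₀, hzero, hzero]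
    · rw [hzero]; exact ENNReal.zero_lt_top
  · rcases h with h | h
    · rw [h, zero_sub] at hsub
      have hneg : x⁻ = -x := by rw [← neg_eq_iff_eq_neg, hsub]
      have hnorm : ‖x⁻‖ = ‖x‖ := by rw [hneg, norm_neg]
      have hne : x⁻ ≠ 0 := by rwa [hneg, neg_ne_zero]
      refine exists_extension_of_mem_spectrum hx φ (neg_norm_negPart_mem_spectrum hx hne)
        (neg_ne_zero.2 (norm_ne_zero_iff.2 hne)) (by rw [abs_neg, abs_norm, hnorm]) ?_
      rw [inv_neg, neg_smul, ← smul_neg, ← map_neg]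
      refine smul_nonneg (inv_nonneg.2 (norm_nonneg _)) (apply_nonneg hφ ?_)
      change 0 ≤ -x
      rw [← hneg]
      exact CFC.negPart_nonneg x
    · rw [h, sub_zero] at hsub
      have hne : x⁺ ≠ 0 := by rwa [hsub]
      refine exists_extension_of_mem_spectrum hx φ (norm_posPart_mem_spectrum hx hne)
        (norm_ne_zero_iff.2 hne) (by rw [abs_norm, hsub]) ?_
      refine smul_nonneg (inv_nonneg.2 (norm_nonneg _)) (apply_nonneg hφ ?_)
      change 0 ≤ x
      rw [← hsub]
      exact CFC.posPart_nonneg x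

set_option maxHeartbeats 1000000 in
theorem exists_extension_of_indefinite (hx : IsSelfAdjoint x)
    (φ : Submodule.span ℂ {x} →ₗ[ℂ] (K →L[ℂ] K)) (hφ : IsCompletelyPositive φ)
    (hpos : x⁺ ≠ 0) (hneg : x⁻ ≠ 0) :
    ∃ (ψ : cstarGen (Submodule.span ℂ {x}) →ₗ[ℂ] (K →L[ℂ] K)) (m M : spectrum ℝ x)
      (Q : MeasureTheory.VectorMeasure (spectrum ℝ x) (K →L[ℂ] K)),
      (∀ t : spectrum ℝ x, m ≤ t ∧ t ≤ M) ∧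
      (∀ B : Set (spectrum ℝ x), 0 ≤ Q B) ∧
      (∀ B : Set (spectrum ℝ x), m ∉ B → M ∉ B → Q B = 0) ∧
      IsGivenByMeasure x Q ψ ∧ IsCPExtension φ ψ ∧
      cbNorm ψ ≤ ENNReal.ofReal (‖x‖ / min ‖x⁺‖ ‖x⁻‖) * cbNorm φ ∧ cbNorm ψ < ∞ := by
  have := hx.isStarNormal
  set y := φ ⟨x, Submodule.mem_span_singleton_self x⟩ with hy_def
  have hy : IsSelfAdjoint y := isSelfAdjoint_apply hφ hx
  have ha : 0 < ‖x⁺‖ := norm_pos_iff.2 hpos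
  have hb : 0 < ‖x⁻‖ := norm_pos_iff.2 hneg
  have hmin : 0 < min ‖x⁺‖ ‖x⁻‖ := lt_min ha hb
  let M : spectrum ℝ x := ⟨‖x⁺‖, norm_posPart_mem_spectrum hx hpos⟩
  let m : spectrum ℝ x := ⟨-‖x⁻‖, neg_norm_negPart_mem_spectrum hx hneg⟩
  let M' : spectrum ℂ x := ⟨((M : ℝ) : ℂ), spectrum.algebraMap_mem ℂ M.2⟩
  let m' : spectrum ℂ x := ⟨((m : ℝ) : ℂ), spectrum.algebraMap_mem ℂ m.2⟩
  let p : K →L[ℂ] K := ‖x⁺‖⁻¹ • y⁺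
  let q : K →L[ℂ] K := ‖x⁻‖⁻¹ • y⁻
  have hp : 0 ≤ p := smul_nonneg (inv_nonneg.2 ha.le) (CFC.posPart_nonneg y)
  have hq : 0 ≤ q := smul_nonneg (inv_nonneg.2 hb.le) (CFC.negPart_nonneg y)
  have hpq : p * q = 0 := by
    rw [smul_mul_smul_comm, CFC.posPart_mul_negPart, smul_zero]
  have hypos : ‖y⁺‖ ≤ ‖y‖ := CStarAlgebra.norm_posPart_le y
  have hyneg : ‖y⁻‖ ≤ ‖y‖ := CStarAlgebra.norm_negPart_le y
  have hp_le : ‖p‖ ≤ (min ‖x⁺‖ ‖x⁻‖)⁻¹ * ‖y‖ :=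
    norm_inv_smul_le (v := y⁺) (c := ‖x⁺‖) hmin (min_le_left ‖x⁺‖ ‖x⁻‖) hypos
  have hq_le : ‖q‖ ≤ (min ‖x⁺‖ ‖x⁻‖)⁻¹ * ‖y‖ :=
    norm_inv_smul_le (v := y⁻) (c := ‖x⁻‖) hmin (min_le_right ‖x⁺‖ ‖x⁻‖) hyneg
  have hle := cbNorm_spectralTwoPoint_le M' m' hp hq hpq
  refine ⟨spectralTwoPoint x M' m' p q, m, M, MeasureTheory.VectorMeasure.dirac M p +
    MeasureTheory.VectorMeasure.dirac m q,
    fun t => ⟨neg_norm_negPart_le hx t.2, le_norm_posPart hx t.2⟩,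
    fun B => add_nonneg (dirac_nonneg hp M B) (dirac_nonneg hq m B), fun B hm hM => ?_,
    isGivenByMeasure_spectralTwoPoint M m M' m' rfl rfl p q,
    isCPExtension_spectralTwoPoint M' m' hp hq ?_, hle.trans ?_, hle.trans_lt ENNReal.ofReal_lt_top⟩
  · rw [add_apply, MeasureTheory.VectorMeasure.dirac_apply_of_notMem hM,
      MeasureTheory.VectorMeasure.dirac_apply_of_notMem hm, add_zero]
  · change y = ((‖x⁺‖ : ℝ) : ℂ) • ‖x⁺‖⁻¹ • y⁺ + ((-‖x⁻‖ : ℝ) : ℂ) • ‖x⁻‖⁻¹ • y⁻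
    rw [Complex.coe_smul, Complex.coe_smul, smul_inv_smul₀ ha.ne', neg_smul,
      smul_inv_smul₀ hb.ne', ← sub_eq_add_neg, CFC.posPart_sub_negPart y hy]
  · have hx₀ : 0 < ‖x‖ := ha.trans_le (CStarAlgebra.norm_posPart_le x)
    -- The factor ‖y‖/‖x‖ is split off because it is bounded by ‖φ‖_cb.
    refine le_trans (ENNReal.ofReal_le_ofReal (q := ‖x‖ / min ‖x⁺‖ ‖x⁻‖ * (‖y‖ / ‖x‖)) ?_) ?_
    · have hval : ‖x‖ / min ‖x⁺‖ ‖x⁻‖ * (‖y‖ / ‖x‖) = (min ‖x⁺‖ ‖x⁻‖)⁻¹ * ‖y‖ := by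
        field_simp
      rw [hval]
      exact max_le hp_le hq_le
    · rw [ENNReal.ofReal_mul (by positivity)]
      exact mul_le_mul_right
        (norm_div_le_cbNorm (φ := φ) ⟨x, Submodule.mem_span_singleton_self x⟩) _

end Extension

end OneDimExt

theorem proposition5p4 {H K : Type*}
    [NormedAddCommGroup H] [InnerProductSpace ℂ H] [CompleteSpace H]
    [NormedAddCommGroup K] [InnerProductSpace ℂ K] [CompleteSpace K]
    (x : H →L[ℂ] H) (hx : IsSelfAdjoint x)
    (φ : Submodule.span ℂ {x} →ₗ[ℂ] (K →L[ℂ] K)) (hφ : OneDimExt.IsCompletelyPositive φ) :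
    (∃ ψ : OneDimExt.cstarGen (Submodule.span ℂ {x}) →ₗ[ℂ] (K →L[ℂ] K),
      OneDimExt.IsCPExtension φ ψ ∧ OneDimExt.cbNorm ψ < ∞) ∧
    (x⁺ = 0 ∨ x⁻ = 0 →
      ∃ ψ : OneDimExt.cstarGen (Submodule.span ℂ {x}) →ₗ[ℂ] (K →L[ℂ] K),
        OneDimExt.IsCPExtension φ ψ ∧ OneDimExt.cbNorm ψ = OneDimExt.cbNorm φ) ∧
    (x⁺ ≠ 0 → x⁻ ≠ 0 →
      ∃ (ψ : OneDimExt.cstarGen (Submodule.span ℂ {x}) →ₗ[ℂ] (K →L[ℂ] K))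
        (m M : spectrum ℝ x)
        (Q : MeasureTheory.VectorMeasure (spectrum ℝ x) (K →L[ℂ] K)),
        (∀ t : spectrum ℝ x, m ≤ t ∧ t ≤ M) ∧
        (∀ B : Set (spectrum ℝ x), 0 ≤ Q B) ∧
        (∀ B : Set (spectrum ℝ x), m ∉ B → M ∉ B → Q B = 0) ∧
        OneDimExt.IsGivenByMeasure x Q ψ ∧
        OneDimExt.IsCPExtension φ ψ ∧
        OneDimExt.cbNorm φ ≤ OneDimExt.cbNorm ψ ∧
        OneDimExt.cbNorm ψ ≤
          ENNReal.ofReal (‖x‖ / min ‖x⁺‖ ‖x⁻‖) * OneDimExt.cbNorm φ) := by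
  refine ⟨?_, fun h => ?_, fun hpos hneg => ?_⟩
  · by_cases h : x⁺ = 0 ∨ x⁻ = 0
    · obtain ⟨ψ, hψ, -, hfin⟩ := OneDimExt.exists_extension_of_semidefinite hx φ hφ h
      exact ⟨ψ, hψ, hfin⟩
    · obtain ⟨hpos, hneg⟩ := not_or.1 h
      obtain ⟨ψ, -, -, -, -, -, -, -, hψ, -, hfin⟩ :=
        OneDimExt.exists_extension_of_indefinite hx φ hφ hpos hneg
      exact ⟨ψ, hψ, hfin⟩
  · obtain ⟨ψ, hψ, hnorm, -⟩ := OneDimExt.exists_extension_of_semidefinite hx φ hφ h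
    exact ⟨ψ, hψ, hnorm⟩
  · obtain ⟨ψ, m, M, Q, hmM, hQ, hsupp, hint, hψ, hle, -⟩ :=
      OneDimExt.exists_extension_of_indefinite hx φ hφ hpos hneg
    exact ⟨ψ, m, M, Q, hmM, hQ, hsupp, hint, hψ, OneDimExt.cbNorm_le_of_isCPExtension hψ, hle⟩
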